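/- Let $X$ be a separable real Banach space, $Y$ a real Banach space, $G\subset X$ an open set, and $f:G\to Y$ a map. A set has the Baire property if it belongs to the smallest $\sigma$-algebra containing all open sets and all sets of the first category, and $f$ has the Baire property if $f^{-1}(B)$ has the Baire property in $G$ for every Borel set $B\subset Y$. The map $f$ is Gâteaux differentiable at $x\in G$ if there is a continuous linear operator $L:X\to Y$ such that $\lim_{t\to 0}\frac{f(x+tv)-f(x)}{t}=L(v)$ for every $v\in X$; it is Hadamard differentiable at $x$ if there is such an $L$ for which, moreover, the limit is uniform with respect to $v\in C$ for every compact set $C\subset X$. A set $A\subset X$ is directionally porous if for every $x\in A$ there exist $0\neq v\in X$, $p>0$ and a sequence of positive reals $t_n\to 0$ such that $B(x+t_nv,\,p\,t_n)\cap A=\emptyset$ for all $n$, where $B(y,r)$ is the open ball with center $y$ and radius $r$; $A$ is $\sigma$-directionally porous if it is a countable union of directionally porous sets. Theorem. Suppose that $f$ has the Baire property and is Gâteaux differentiable at every point of $G$. Then the set of all points $x\in G$ at which $f$ is not Hadamard differentiable is nowhere dense and $\sigma$-directionally porous. -/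

import Mathlib

open Filter Topology Metric Set

/-- A map `f` has the Baire property if it is measurable from the σ-algebra of sets with the
Baire property to the Borel σ-algebra. -/
def HasBaireProperty {α β : Type*} [TopologicalSpace α] [TopologicalSpace β] (f : α → β) : Prop :=
  ∀ B : Set β, @MeasurableSet β (borel β) B → BaireMeasurableSet (f ⁻¹' B)

section Derivatives

variable {X Y : Type*} [NormedAddCommGroup X] [NormedSpace ℝ X]
  [NormedAddCommGroup Y] [NormedSpace ℝ Y]

/-- The continuous linear map `L` is the Gâteaux derivative of `f` at `x`:
`(f (x + t v) - f x) / t → L v` as `t → 0`, for every `v`. -/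
def HasGateauxDerivAt (f : X → Y) (L : X →L[ℝ] Y) (x : X) : Prop :=
  ∀ v : X, Tendsto (fun t : ℝ => t⁻¹ • (f (x + t • v) - f x)) (𝓝[≠] 0) (𝓝 (L v))

/-- `f` is Gâteaux differentiable at `x`. -/
def GateauxDifferentiableAt (f : X → Y) (x : X) : Prop :=
  ∃ L : X →L[ℝ] Y, HasGateauxDerivAt f L x

/-- The continuous linear map `L` is the Hadamard derivative of `f` at `x`: the difference
quotients converge pointwise to `L`, uniformly on each compact set of directions. -/
def HasHadamardDerivAt (f : X → Y) (L : X →L[ℝ] Y) (x : X) : Prop :=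
  HasGateauxDerivAt f L x ∧
    ∀ C : Set X, IsCompact C →
      TendstoUniformlyOn (fun (t : ℝ) (v : X) => t⁻¹ • (f (x + t • v) - f x)) L (𝓝[≠] 0) C

/-- `f` is Hadamard differentiable at `x`. -/
def HadamardDifferentiableAt (f : X → Y) (x : X) : Prop :=
  ∃ L : X →L[ℝ] Y, HasHadamardDerivAt f L x

end Derivatives

section Porosity

variable {X : Type*} [NormedAddCommGroup X] [NormedSpace ℝ X]

/-- `A` is directionally porous at `x`: for some `v ≠ 0`, `p > 0` and some sequence of positive
`t n → 0`, the open balls `B (x + t n v, p t n)` all miss `A`. -/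
def DirectionallyPorousAt (A : Set X) (x : X) : Prop :=
  ∃ v : X, v ≠ 0 ∧ ∃ p : ℝ, 0 < p ∧ ∃ t : ℕ → ℝ, (∀ n, 0 < t n) ∧ Tendsto t atTop (𝓝 0) ∧
    ∀ n, ball (x + t n • v) (p * t n) ∩ A = ∅

/-- `A` is directionally porous at each of its points. -/
def DirectionallyPorous (A : Set X) : Prop :=
  ∀ x ∈ A, DirectionallyPorousAt A x

/-- `A` is a countable union of directionally porous sets. -/
def SigmaDirectionallyPorous (A : Set X) : Prop :=
  ∃ S : ℕ → Set X, (∀ n, DirectionallyPorous (S n)) ∧ A = ⋃ n, S n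

end Porosity

/-!
The proof rests on one consequence of the Baire category theorem. Fix `x ∈ G`. The sets `V n` of
directions `v` with `‖f (x + q • v) - f x‖ ≤ n * q` for all rational `q > 0` with `n * q < 1` and
`x + q • v ∈ G` have the Baire property, and by Gâteaux differentiability at `x` they cover `X`;
hence some `V n` is residual in a nonempty open set of directions, i.e. `f` has linear growth at
`x` along a residual part of an open cone. The same holds at every point `y` of this cone, so generic points of a tiny
cone at `y` are good for `x` and for `y` simultaneously. Letting the second cone shrink to `y`
gives the linear growth at `x` on the *whole* open cone (`exists_coneBound`). No separability of
the range is needed, as only preimages of closed balls enter.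

Consequently `G` is covered by countably many sets `A` on each of which a cone condition holds with
fixed data. If `A` is not directionally porous at `x` in the direction opposite to the axis of the
cone, any `y` close to `x` lies together with `x` in a cone of comparable size with vertex in `A`,
which bounds `‖f y - f x‖` by a multiple of `‖y - x‖` (`ConeBound.eventually_le`). So the points
where `f` is not pointwise Lipschitz form a `σ`-directionally porous set. At a point `x` of the
set of points with a fixed pointwise Lipschitz constant, failure of Hadamard differentiability in
spite of Gâteaux differentiability forces this set to be directionally porous at `x`, in a
direction where uniformity of the difference quotients breaks down (`Calm.equidirectional`).

For nowhere density, in every nonempty open subset of `G` one of the sets `A` is dense in some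
smaller open set, where the cone argument shows that `f` is locally Lipschitz, hence Hadamard
differentiable.
-/

/-! ### Sets with the Baire property -/

section Category

variable {X : Type*} [TopologicalSpace X]

theorem BaireMeasurableSet.image_val {G : Set X} (hG : IsOpen G) {s : Set G}
    (hs : BaireMeasurableSet s) : BaireMeasurableSet (Subtype.val '' s) := by
  obtain ⟨u, hu, hsu⟩ := hs.residualEq_isOpen
  have hmeagre : IsMeagre {x : G | ¬ (x ∈ s ↔ x ∈ u)} := by
    have h := Filter.eventuallyEq_set.1 hsu
    unfold IsMeagre
    filter_upwards [h] with x hx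
    simpa using hx
  refine (hG.isOpenMap_subtype_val u hu).baireMeasurableSet.congr ?_
  rw [Filter.eventuallyEq_set]
  have h : {x : X | ¬ x ∈ Subtype.val '' {x : G | ¬ (x ∈ s ↔ x ∈ u)}} ∈ residual X :=
    hmeagre.image_val
  filter_upwards [h] with x hx
  by_cases hxG : x ∈ G
  · simp only [mem_image, mem_ofPred_eq, Subtype.exists, exists_and_right, exists_eq_right, hxG,
      exists_true_left] at hx ⊢
    tauto
  · simp [hxG]

/-- If countably many sets with the Baire property cover a Baire space, one of them contains
residually many points of some nonempty open set. -/
theorem exists_eventually_residual_of_iUnion_eq_univ [BaireSpace X] [Nonempty X]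
    {V : ℕ → Set X} (hV : ∀ n, BaireMeasurableSet (V n)) (hcover : ⋃ n, V n = univ) :
    ∃ n, ∃ U : Set X, IsOpen U ∧ U.Nonempty ∧ ∀ᶠ v in residual X, v ∈ U → v ∈ V n := by
  choose U hU hVU using fun n => (hV n).residualEq_isOpen
  by_contra! hcon
  have hempty : ∀ n, U n = ∅ := fun n => by
    by_contra hne
    refine hcon n (U n) (hU n) (nonempty_iff_ne_empty.2 hne) ?_
    filter_upwards [Filter.eventuallyEq_set.1 (hVU n)] with v hv
    exact fun h => h.2 (hv.2 h.1)
  have hfalse : ∀ᶠ v in residual X, ∀ n, v ∉ V n := by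
    rw [eventually_countable_forall]
    intro n
    filter_upwards [Filter.eventuallyEq_set.1 (hVU n)] with v hv
    simp [hv, hempty n]
  obtain ⟨v, hv⟩ := (dense_of_mem_residual hfalse).nonempty
  obtain ⟨n, hn⟩ := mem_iUnion.1 (hcover ▸ mem_univ v)
  exact hv n hn

theorem HasBaireProperty.baireMeasurableSet_imp {Y : Type*} [TopologicalSpace Y] {G : Set X}
    (hG : IsOpen G) {f : X → Y} (hf : HasBaireProperty (G.domRestrict f)) {K : Set Y}
    (hK : IsClosed K) : BaireMeasurableSet {x | x ∈ G → f x ∈ K} := by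
  have hB : @MeasurableSet Y (borel Y) Kᶜ := by
    borelize Y
    exact hK.measurableSet.compl
  convert ((hf _ hB).image_val hG).compl using 1
  ext x
  by_cases hx : x ∈ G <;> simp [hx]

end Category

/-! ### Linear growth on cones -/

section Cones

variable {X Y : Type*} [NormedAddCommGroup X] [NormedSpace ℝ X]
  [NormedAddCommGroup Y]

/-- The growth of `f` at `x` is linear with constant `n`, up to scale `1 / n`, on the part in `G`
of the open cone with vertex `x` generated by `ball v r`. -/
def ConeBound (f : X → Y) (G : Set X) (n : ℕ) (v : X) (r : ℝ) (x : X) : Prop :=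
  ∀ t : ℝ, 0 < t → n * t < 1 → ∀ w ∈ ball v r, x + t • w ∈ G → ‖f (x + t • w) - f x‖ ≤ n * t

/-- The directions in which the growth of `f` at `x` is linear with constant `n` up to scale
`1 / n`. Only rational scales are tested, so that this is a countable intersection. -/
def goodDirections (f : X → Y) (G : Set X) (x : X) (n : ℕ) : Set X :=
  {v | ∀ q : ℚ, 0 < q → n * (q : ℝ) < 1 → x + (q : ℝ) • v ∈ G →
    ‖f (x + (q : ℝ) • v) - f x‖ ≤ n * q}

/-- The homeomorphism `v ↦ x + t • v`. -/
noncomputable def homothety (x : X) {t : ℝ} (ht : t ≠ 0) : X ≃ₜ X :=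
  (Homeomorph.smulOfNeZero t ht).trans (Homeomorph.addLeft x)

@[simp]
theorem homothety_apply (x : X) {t : ℝ} (ht : t ≠ 0) (v : X) : homothety x ht v = x + t • v := rfl

theorem baireMeasurableSet_goodDirections {G : Set X} (hG : IsOpen G) {f : X → Y}
    (hf : HasBaireProperty (G.domRestrict f)) (x : X) (n : ℕ) :
    BaireMeasurableSet (goodDirections f G x n) := by
  have : goodDirections f G x n = ⋂ q : ℚ, ⋂ _ : 0 < q, ⋂ _ : n * (q : ℝ) < 1,
      {v | x + (q : ℝ) • v ∈ G → f (x + (q : ℝ) • v) ∈ closedBall (f x) (n * q)} := by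
    ext v
    simp [goodDirections, dist_eq_norm]
  rw [this]
  refine .iInter fun q => .iInter fun hq => .iInter fun _ => ?_
  have hq' : (q : ℝ) ≠ 0 := by exact_mod_cast hq.ne'
  exact (hf.baireMeasurableSet_imp hG (isClosed_closedBall (x := f x) (ε := n * q))).preimage
    (homothety x hq').continuous (homothety x hq').isOpenMap

theorem iUnion_goodDirections [NormedSpace ℝ Y] {G : Set X} {f : X → Y} {x : X}
    (hx : GateauxDifferentiableAt f x) : ⋃ n, goodDirections f G x n = univ := by
  obtain ⟨L, hL⟩ := hx
  refine eq_univ_of_forall fun v => mem_iUnion.2 ?_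
  have h1 : ∀ᶠ t : ℝ in 𝓝[≠] 0, ‖t⁻¹ • (f (x + t • v) - f x)‖ < ‖L v‖ + 1 :=
    (hL v).norm.eventually_lt_const (by linarith)
  rw [eventually_nhdsWithin_iff, Metric.eventually_nhds_iff] at h1
  obtain ⟨δ, hδ, h1⟩ := h1
  obtain ⟨n, hn⟩ := exists_nat_ge (max (‖L v‖ + 1) (1 / δ))
  refine ⟨n, fun q hq hnq _ => ?_⟩
  have hq' : (0 : ℝ) < q := by exact_mod_cast hq
  have hn1 := (le_max_left _ _).trans hn
  have hn2 := (le_max_right _ _).trans hn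
  rw [div_le_iff₀ hδ] at hn2
  have hn0 : (0 : ℝ) < n := lt_of_lt_of_le (by positivity) hn1
  have hqδ : (q : ℝ) < δ := lt_of_mul_lt_mul_left (hnq.trans_le hn2) hn0.le
  have := h1 (y := q) (by rwa [dist_zero_right, Real.norm_of_nonneg hq'.le]) hq'.ne'
  rw [norm_smul, norm_inv, Real.norm_of_nonneg hq'.le, inv_mul_lt_iff₀ hq'] at this
  nlinarith

theorem exists_residual_goodDirections [NormedSpace ℝ Y] [CompleteSpace X]
    {G : Set X} (hG : IsOpen G) {f : X → Y}
    (hf : HasBaireProperty (G.domRestrict f)) {x : X} (hx : GateauxDifferentiableAt f x) :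
    ∃ n, ∃ U : Set X, IsOpen U ∧ U.Nonempty ∧
      ∀ᶠ v in residual X, v ∈ U → v ∈ goodDirections f G x n :=
  exists_eventually_residual_of_iUnion_eq_univ (baireMeasurableSet_goodDirections hG hf x)
    (iUnion_goodDirections hx)

theorem eventually_residual_homothety (x : X) {t : ℝ} (ht : t ≠ 0) {p : X → Prop}
    (hp : ∀ᶠ v in residual X, p v) : ∀ᶠ z in residual X, p (t⁻¹ • (z - x)) := by
  have h := tendsto_residual_of_isOpenMap (homothety x ht).symm.continuous
    (homothety x ht).symm.isOpenMap
  filter_upwards [h.eventually hp] with z hz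
  have : (homothety x ht).symm z = t⁻¹ • (z - x) := by
    rw [Homeomorph.symm_apply_eq]
    simp [ht]
  rwa [this] at hz

/-- Linear growth at `x` in residually many directions of a ball extends to all its directions. -/
theorem coneBound_of_residual [NormedSpace ℝ Y] [CompleteSpace X]
    {G : Set X} (hG : IsOpen G) {f : X → Y}
    (hf : HasBaireProperty (G.domRestrict f)) (hdiff : ∀ x ∈ G, GateauxDifferentiableAt f x)
    {x v : X} {r : ℝ} {n : ℕ}
    (hx : ∀ᶠ w in residual X, w ∈ ball v r → w ∈ goodDirections f G x n) :
    ConeBound f G n v r x := by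
  intro t ht hnt w hw hy
  set y := x + t • w with hy_def
  obtain ⟨m, U, hU, ⟨u, hu⟩, hm⟩ := exists_residual_goodDirections hG hf (hdiff y hy)
  refine le_of_forall_pos_le_add fun ε hε => ?_
  -- a rational scale `q ≈ t` at which `y` still lies in the cone with vertex `x`
  obtain ⟨q, hq0, hqn, hqε, hqw⟩ : ∃ q : ℚ, 0 < q ∧ n * (q : ℝ) < 1 ∧
      n * (q : ℝ) < n * t + ε / 2 ∧ (q : ℝ)⁻¹ • (y - x) ∈ ball v r := by
    have hev : ∀ᶠ s : ℝ in 𝓝 t, 0 < s ∧ n * s < 1 ∧ n * s < n * t + ε / 2 ∧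
        s⁻¹ • (y - x) ∈ ball v r := by
      have hc : ContinuousAt (fun s : ℝ => (n : ℝ) * s) t := by fun_prop
      have hc' : ContinuousAt (fun s : ℝ => s⁻¹ • (y - x)) t :=
        (continuousAt_inv₀ ht.ne').smul continuousAt_const
      refine (lt_mem_nhds ht).and ((hc.eventually_lt_const hnt).and
        ((hc.eventually_lt_const (by linarith)).and
        (hc'.eventually_mem (isOpen_ball.mem_nhds ?_))))
      simpa [hy_def, ht.ne'] using hw
    obtain ⟨s, hs, q, rfl⟩ :=
      mem_closure_iff_nhds.1 (Rat.denseRange_cast (𝕜 := ℝ) t) _ hev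
    exact ⟨q, by exact_mod_cast hs.1, hs.2.1, hs.2.2.1, hs.2.2.2⟩
  have hq0' : (0 : ℝ) < q := by exact_mod_cast hq0
  -- a small rational scale `s` at which the cone with vertex `y` meets the one with vertex `x`
  obtain ⟨s, hs0, hsm, hsε, hsG, hsw⟩ : ∃ s : ℚ, 0 < s ∧ m * (s : ℝ) < 1 ∧
      m * (s : ℝ) < ε / 2 ∧ y + (s : ℝ) • u ∈ G ∧
        (q : ℝ)⁻¹ • (y + (s : ℝ) • u - x) ∈ ball v r := by
    have hev : ∀ᶠ s : ℝ in 𝓝 0, m * s < 1 ∧ m * s < ε / 2 ∧ y + s • u ∈ G ∧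
        (q : ℝ)⁻¹ • (y + s • u - x) ∈ ball v r := by
      have hc : ContinuousAt (fun s : ℝ => (m : ℝ) * s) 0 := by fun_prop
      have hc' : ContinuousAt (fun s : ℝ => y + s • u) 0 := by fun_prop
      have hc'' : ContinuousAt (fun s : ℝ => (q : ℝ)⁻¹ • (y + s • u - x)) 0 := by fun_prop
      exact (hc.eventually_lt_const (by simp)).and
        ((hc.eventually_lt_const (by simpa using hε)).and
        ((hc'.eventually_mem (hG.mem_nhds (by simpa using hy))).and
        (hc''.eventually_mem (isOpen_ball.mem_nhds (by simpa using hqw)))))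
    obtain ⟨δ, hδ, hδs⟩ := Metric.eventually_nhds_iff.1 hev
    obtain ⟨s, hs0, hsδ⟩ := exists_rat_btwn hδ
    have := hδs (y := s) (by rwa [dist_zero_right, Real.norm_of_nonneg hs0.le])
    exact ⟨s, by exact_mod_cast hs0, this⟩
  have hs0' : (0 : ℝ) < s := by exact_mod_cast hs0
  have hgen := (eventually_residual_homothety x hq0'.ne' hx).and
    (eventually_residual_homothety y hs0'.ne' hm)
  set W : Set X := G ∩ ((fun z => (q : ℝ)⁻¹ • (z - x)) ⁻¹' ball v r ∩
    (fun z => (s : ℝ)⁻¹ • (z - y)) ⁻¹' U) with hW_def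
  have hW : IsOpen W := hG.inter ((isOpen_ball.preimage (by fun_prop)).inter
    (hU.preimage (by fun_prop)))
  have hWne : W.Nonempty := ⟨y + (s : ℝ) • u, hsG, hsw, by simpa [hs0'.ne'] using hu⟩
  obtain ⟨z, ⟨hzG, hz1, hz2⟩, hz⟩ := (dense_of_mem_residual hgen).inter_open_nonempty W hW hWne
  have hzx := hz.1 hz1 q hq0 hqn
  have hzy := hz.2 hz2 s hs0 hsm
  rw [smul_inv_smul₀ hq0'.ne', add_sub_cancel] at hzx
  rw [smul_inv_smul₀ hs0'.ne', add_sub_cancel] at hzy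
  calc ‖f y - f x‖ ≤ ‖f z - f x‖ + ‖f z - f y‖ := by
        rw [show f y - f x = (f z - f x) - (f z - f y) by abel]
        exact norm_sub_le _ _
    _ ≤ n * t + ε := by linarith [hzx hzG, hzy hzG]

/-- Every point of `G` is the vertex of an open cone on which `f` grows linearly. The axis and the
opening of the cone are taken from a countable family. -/
theorem exists_coneBound [NormedSpace ℝ Y] [CompleteSpace X]
    [TopologicalSpace.SeparableSpace X] {G : Set X} (hG : IsOpen G) {f : X → Y}
    (hf : HasBaireProperty (G.domRestrict f))
    (hdiff : ∀ x ∈ G, GateauxDifferentiableAt f x) {x : X} (hx : x ∈ G) :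
    ∃ i : ℕ × ℕ × ℕ,
      ConeBound f G i.1 (TopologicalSpace.denseSeq X i.2.1) (1 / ((i.2.2 : ℝ) + 1)) x := by
  obtain ⟨n, U, hU, hUne, hn⟩ := exists_residual_goodDirections hG hf (hdiff x hx)
  obtain ⟨k, hk⟩ := (TopologicalSpace.denseRange_denseSeq X).exists_mem_open hU hUne
  obtain ⟨ε, hε, hεU⟩ := Metric.isOpen_iff.1 hU _ hk
  obtain ⟨j, hj⟩ := exists_nat_one_div_lt hε
  refine ⟨(n, k, j), coneBound_of_residual hG hf hdiff ?_⟩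
  filter_upwards [hn] with v hv hvb
  exact hv (hεU (ball_subset_ball hj.le hvb))

/-- The scale `t = 2 / r * ‖y - x‖` is chosen so that both `x` and `y` lie in `a + t • ball v r`;
the bounds for `‖f x - f a‖` and `‖f y - f a‖` add up. -/
theorem ConeBound.norm_image_sub_le {f : X → Y} {G : Set X} {n : ℕ} {v : X} {r : ℝ} (hr : 0 < r)
    {a x y : X} (ha : ConeBound f G n v r a) (hx : x ∈ G) (hy : y ∈ G) (hxy : 0 < ‖y - x‖)
    (hn : n * (2 / r * ‖y - x‖) < 1)
    (hax : a ∈ ball (x + (2 / r * ‖y - x‖) • (-v)) (r / 2 * (2 / r * ‖y - x‖))) :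
    ‖f y - f x‖ ≤ 4 * n / r * ‖y - x‖ := by
  set t := 2 / r * ‖y - x‖ with ht_def
  have ht : 0 < t := by positivity
  have hrt : ‖y - x‖ = r / 2 * t := by rw [ht_def]; field_simp
  rw [mem_ball, dist_eq_norm] at hax
  have key : ∀ z ∈ G, ‖z - x‖ ≤ r / 2 * t → ‖f z - f a‖ ≤ n * t := by
    intro z hz hzx
    have hzt : a + t • (t⁻¹ • (z - a)) = z := by
      rw [smul_inv_smul₀ ht.ne']; abel
    have h := ha t ht hn (t⁻¹ • (z - a)) ?_ (by rwa [hzt])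
    · rwa [hzt] at h
    have hlt : ‖(z - a) - t • v‖ < t * r := by
      calc ‖(z - a) - t • v‖ = ‖(z - x) - (a - (x + t • (-v)))‖ := by
            congr 1; rw [smul_neg]; abel
        _ ≤ ‖z - x‖ + ‖a - (x + t • (-v))‖ := norm_sub_le _ _
        _ < t * r := by linarith
    have heq : t⁻¹ • (z - a) - v = t⁻¹ • ((z - a) - t • v) := by
      rw [smul_sub t⁻¹ (z - a), inv_smul_smul₀ ht.ne']
    rw [mem_ball, dist_eq_norm, heq, norm_smul, norm_inv, Real.norm_of_nonneg ht.le,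
      inv_mul_lt_iff₀ ht]
    exact hlt
  have h1 := key y hy hrt.le
  have h2 := key x hx (by simp; positivity)
  calc ‖f y - f x‖ = ‖(f y - f a) - (f x - f a)‖ := by congr 1; abel
    _ ≤ ‖f y - f a‖ + ‖f x - f a‖ := norm_sub_le _ _
    _ ≤ 2 * n * t := by linarith
    _ = 4 * n / r * ‖y - x‖ := by rw [ht_def]; ring

end Cones

/-! ### Directional porosity -/

section PorosityLemmas

variable {X : Type*} [NormedAddCommGroup X] [NormedSpace ℝ X]

theorem DirectionallyPorousAt.mono {A B : Set X} {x : X} (h : DirectionallyPorousAt B x)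
    (hAB : A ⊆ B) : DirectionallyPorousAt A x := by
  obtain ⟨v, hv, p, hp, t, ht, ht0, hB⟩ := h
  refine ⟨v, hv, p, hp, t, ht, ht0, fun n => ?_⟩
  exact subset_empty_iff.1 ((inter_subset_inter_right _ hAB).trans (hB n).subset)

/-- At a point of `A` where `A` is not directionally porous, `A` meets all small balls in question;
for `v = 0` the point itself is a witness. -/
theorem eventually_nonempty_of_not_directionallyPorousAt {A : Set X} {x : X} (hx : x ∈ A)
    (h : ¬ DirectionallyPorousAt A x) (v : X) {p : ℝ} (hp : 0 < p) :
    ∀ᶠ t : ℝ in 𝓝[>] 0, ∃ a ∈ A, a ∈ ball (x + t • v) (p * t) := by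
  rcases eq_or_ne v 0 with rfl | hv
  · filter_upwards [self_mem_nhdsWithin] with t ht
    exact ⟨x, hx, by simpa using mul_pos hp ht⟩
  by_contra hcon
  rw [not_eventually] at hcon
  obtain ⟨t, ht, htA⟩ :=
    exists_seq_forall_of_frequently (hcon.and_eventually self_mem_nhdsWithin)
  refine h ⟨v, hv, p, hp, t, fun n => (htA n).2, ht.mono_right nhdsWithin_le_nhds, fun n => ?_⟩
  refine eq_empty_iff_forall_notMem.2 fun a ha => (htA n).1 ⟨a, ha.2, ha.1⟩

theorem sigmaDirectionallyPorous_iUnion {ι : Type*} [Countable ι] [Nonempty ι] {S : ι → Set X}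
    (h : ∀ i, DirectionallyPorous (S i)) : SigmaDirectionallyPorous (⋃ i, S i) := by
  obtain ⟨e, he⟩ := exists_surjective_nat ι
  exact ⟨S ∘ e, fun n => h _, (he.iUnion_comp S).symm⟩

end PorosityLemmas

/-! ### From pointwise Lipschitz estimates to Hadamard differentiability -/

section Hadamard

variable {X Y : Type*} [NormedAddCommGroup X] [NormedSpace ℝ X]
  [NormedAddCommGroup Y]

/-- `f` is pointwise Lipschitz at `x` with constant `n`, on the ball of radius `1 / n`. -/
def Calm {E F : Type*} [NormedAddCommGroup E] [NormedAddCommGroup F]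
    (f : E → F) (n : ℕ) (x : E) : Prop :=
  ∀ y, n * ‖y - x‖ < 1 → ‖f y - f x‖ ≤ n * ‖y - x‖

/-- The one-sided difference quotients of `f` at `x` at small scales depend on the direction in
an equicontinuous way. -/
def Equidirectional (f : X → Y) (x : X) : Prop :=
  ∀ v : X, ∀ ε : ℝ, 0 < ε → ∃ p : ℝ, 0 < p ∧ ∀ᶠ t : ℝ in 𝓝[>] 0, ∀ w ∈ ball v p,
    ‖f (x + t • w) - f (x + t • v)‖ ≤ ε * t

theorem exists_calm {E F : Type*} [NormedAddCommGroup E] [NormedAddCommGroup F]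
    {f : E → F} {x : E} {K : ℝ}
    (h : ∀ᶠ y in 𝓝 x, ‖f y - f x‖ ≤ K * ‖y - x‖) : ∃ n, Calm f n x := by
  obtain ⟨δ, hδ, h⟩ := Metric.eventually_nhds_iff.1 h
  obtain ⟨n, hn⟩ := exists_nat_ge (max K (1 / δ))
  have hn2 := (le_max_right _ _).trans hn
  have hn0 : (0 : ℝ) < n := lt_of_lt_of_le (by positivity) hn2
  rw [div_le_iff₀ hδ] at hn2
  refine ⟨n, fun y hy => (h ?_).trans ?_⟩
  · rw [dist_eq_norm]
    exact lt_of_mul_lt_mul_left (hy.trans_le hn2) hn0.le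
  · exact mul_le_mul_of_nonneg_right ((le_max_left _ _).trans hn) (norm_nonneg _)

theorem ConeBound.eventually_le {f : X → Y} {G : Set X} (hG : IsOpen G) {n : ℕ} {v : X} {r : ℝ}
    (hr : 0 < r) {x : X} (hx : x ∈ G) (hxc : ConeBound f G n v r x)
    (hpor : ¬ DirectionallyPorousAt {a | ConeBound f G n v r a} x) :
    ∀ᶠ y in 𝓝 x, ‖f y - f x‖ ≤ 4 * n / r * ‖y - x‖ := by
  have h1 := eventually_nonempty_of_not_directionallyPorousAt hxc hpor (-v) (half_pos hr)
  rw [eventually_nhdsWithin_iff] at h1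
  have hlim : Tendsto (fun y => 2 / r * ‖y - x‖) (𝓝 x) (𝓝 0) := by
    have : ContinuousAt (fun y => 2 / r * ‖y - x‖) x := by fun_prop
    simpa [ContinuousAt] using this
  have hlim' : Tendsto (fun y => n * (2 / r * ‖y - x‖)) (𝓝 x) (𝓝 0) := by
    simpa using hlim.const_mul (n : ℝ)
  filter_upwards [hG.mem_nhds hx, hlim.eventually h1, hlim'.eventually_lt_const one_pos]
    with y hyG hy hyn
  rcases eq_or_ne y x with rfl | hne
  · simp
  have hpos : 0 < ‖y - x‖ := norm_pos_iff.2 (sub_ne_zero.2 hne)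
  obtain ⟨a, ha, hax⟩ := hy (show (0 : ℝ) < _ by positivity)
  exact ConeBound.norm_image_sub_le hr ha hx hyG hpos hyn hax

/-- Where the set of points with pointwise Lipschitz constant `m` is not directionally porous, the
points `x + t • w` with `w` close to `v` are all close to some point of that set. -/
theorem Calm.equidirectional {f : X → Y} {m : ℕ} {x : X} (hx : Calm f m x)
    (hpor : ¬ DirectionallyPorousAt {a | Calm f m a} x) : Equidirectional f x := by
  intro v ε hε
  -- the final estimate is `3 * m * p * t`
  set p := ε / (3 * (m + 1)) with hp_def
  have hp : 0 < p := by positivity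
  have hpm : 3 * (m + 1) * p = ε := by rw [hp_def]; field_simp
  refine ⟨p, hp, ?_⟩
  have hsmall : ∀ᶠ t : ℝ in 𝓝[>] 0, m * (2 * p * t) < 1 := by
    have hc : ContinuousAt (fun t : ℝ => m * (2 * p * t)) 0 := by fun_prop
    exact (hc.eventually_lt_const (by simp)).filter_mono nhdsWithin_le_nhds
  filter_upwards [eventually_nonempty_of_not_directionallyPorousAt hx hpor v hp, hsmall,
    self_mem_nhdsWithin] with t ⟨a, ha, hat⟩ hmt (ht : 0 < t) w hw
  rw [mem_ball, dist_comm, dist_eq_norm] at hat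
  rw [mem_ball, dist_eq_norm] at hw
  have hw' : ‖x + t • w - a‖ ≤ 2 * p * t := by
    calc ‖x + t • w - a‖ = ‖t • (w - v) + (x + t • v - a)‖ := by
          congr 1; rw [smul_sub]; abel
      _ ≤ ‖t • (w - v)‖ + ‖x + t • v - a‖ := norm_add_le _ _
      _ ≤ 2 * p * t := by
          rw [norm_smul, Real.norm_of_nonneg ht.le]
          nlinarith
  have hm : (0 : ℝ) ≤ m := m.cast_nonneg
  have hpt : 0 < p * t := by positivity
  have hv' : ‖x + t • v - a‖ ≤ 2 * p * t := by linarith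
  have e1 := ha _ ((mul_le_mul_of_nonneg_left hw' hm).trans_lt hmt)
  have e2 := ha _ ((mul_le_mul_of_nonneg_left hv' hm).trans_lt hmt)
  have e3 := mul_le_mul_of_nonneg_left hw' hm
  have e4 := mul_le_mul_of_nonneg_left hat.le hm
  calc ‖f (x + t • w) - f (x + t • v)‖
      = ‖(f (x + t • w) - f a) - (f (x + t • v) - f a)‖ := by congr 1; abel
    _ ≤ ‖f (x + t • w) - f a‖ + ‖f (x + t • v) - f a‖ := norm_sub_le _ _
    _ ≤ 3 * m * (p * t) := by linarith
    _ ≤ ε * t := by rw [← hpm]; nlinarith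

theorem equidirectional_of_lipschitz {f : X → Y} {x : X} {K : ℝ}
    (h : ∀ᶠ z : X × X in 𝓝 (x, x), ‖f z.1 - f z.2‖ ≤ K * ‖z.1 - z.2‖) : Equidirectional f x := by
  intro v ε hε
  set p := ε / (|K| + 1) with hp_def
  have hp : 0 < p := by positivity
  have hpK : (|K| + 1) * p = ε := by rw [hp_def]; field_simp
  refine ⟨p, hp, ?_⟩
  obtain ⟨δ, hδ, h⟩ := Metric.eventually_nhds_iff.1 h
  have hsmall : ∀ᶠ t : ℝ in 𝓝[>] 0, t * (‖v‖ + p) < δ := by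
    have hc : ContinuousAt (fun t : ℝ => t * (‖v‖ + p)) 0 := by fun_prop
    exact (hc.eventually_lt_const (by simpa using hδ)).filter_mono nhdsWithin_le_nhds
  filter_upwards [hsmall, self_mem_nhdsWithin] with t htδ (ht : 0 < t) w hw
  have near : ∀ u ∈ ball v p, dist (x + t • u) x < δ := by
    intro u hu
    rw [mem_ball, dist_eq_norm] at hu
    have hu' : ‖u‖ ≤ ‖v‖ + p := by
      have := norm_add_le v (u - v)
      rw [add_sub_cancel] at this
      linarith
    rw [dist_eq_norm, add_sub_cancel_left, norm_smul, Real.norm_of_nonneg ht.le]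
    exact (mul_le_mul_of_nonneg_left hu' ht.le).trans_lt htδ
  have hb := h (y := (x + t • w, x + t • v))
    (by rw [Prod.dist_eq]; exact max_lt (near w hw) (near v (mem_ball_self hp)))
  rw [mem_ball, dist_eq_norm] at hw
  have heq : ‖x + t • w - (x + t • v)‖ = t * ‖w - v‖ := by
    rw [add_sub_add_left_eq_sub, ← smul_sub, norm_smul, Real.norm_of_nonneg ht.le]
  simp only [heq] at hb
  calc ‖f (x + t • w) - f (x + t • v)‖ ≤ K * (t * ‖w - v‖) := hb
    _ ≤ (|K| + 1) * (t * p) := by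
        have := le_abs_self K
        gcongr
        linarith
    _ = ε * t := by rw [← hpK]; ring

/-- Equicontinuity of the difference quotients in the direction upgrades pointwise convergence to
uniform convergence on compact sets. -/
theorem Equidirectional.hasHadamardDerivAt [NormedSpace ℝ Y] {f : X → Y} {x : X} {L : X →L[ℝ] Y}
    (h : Equidirectional f x) (hL : HasGateauxDerivAt f L x) : HasHadamardDerivAt f L x := by
  refine ⟨hL, fun C hC => ?_⟩
  rw [← tendstoLocallyUniformlyOn_iff_tendstoUniformlyOn_of_compact hC,
    Metric.tendstoLocallyUniformlyOn_iff]
  intro ε hε v _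
  have hε3 : 0 < ε / 3 := by positivity
  obtain ⟨p₁, hp₁, h₁⟩ := h v _ hε3
  -- negative `t` correspond to the direction `-v`
  obtain ⟨p₂, hp₂, h₂⟩ := h (-v) _ hε3
  have hLc : ∀ᶠ w in 𝓝 v, ‖L w - L v‖ < ε / 3 := by
    have := (L.continuous.tendsto v).eventually_mem (ball_mem_nhds _ hε3)
    simpa [dist_eq_norm] using this
  refine ⟨{w | ‖L w - L v‖ < ε / 3} ∩ (ball v p₁ ∩ ball v p₂), mem_nhdsWithin_of_mem_nhds
    (inter_mem hLc (inter_mem (ball_mem_nhds v hp₁) (ball_mem_nhds v hp₂))), ?_⟩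
  have hboth : ∀ᶠ t : ℝ in 𝓝[≠] 0, ∀ w ∈ ball v p₁ ∩ ball v p₂,
      ‖f (x + t • w) - f (x + t • v)‖ ≤ ε / 3 * |t| := by
    rw [← nhdsLT_sup_nhdsGT, eventually_sup]
    constructor
    · have hneg : Tendsto (fun t : ℝ => -t) (𝓝[<] 0) (𝓝[>] 0) := by
        simpa using tendsto_neg_nhdsLT (a := (0 : ℝ))
      filter_upwards [hneg.eventually h₂, self_mem_nhdsWithin] with t ht (ht0 : t < 0) w hw
      have := ht (-w) (by simpa only [mem_ball, dist_neg_neg] using hw.2)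
      simpa [abs_of_neg ht0] using this
    · filter_upwards [h₁, self_mem_nhdsWithin] with t ht (ht0 : 0 < t) w hw
      rw [abs_of_pos ht0]
      exact ht w hw.1
  have hLv := (hL v).eventually_mem (ball_mem_nhds _ hε3)
  filter_upwards [hboth, hLv, self_mem_nhdsWithin] with t ht htL (ht0 : t ≠ 0) w hw
  have e1 := ht w hw.2
  have e2 : ‖t⁻¹ • (f (x + t • w) - f (x + t • v))‖ ≤ ε / 3 := by
    rw [norm_smul, norm_inv, Real.norm_eq_abs, inv_mul_le_iff₀ (abs_pos.2 ht0)]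
    linarith
  rw [mem_ball, dist_eq_norm] at htL
  have e3 : ‖L w - L v‖ < ε / 3 := hw.1
  rw [dist_comm, dist_eq_norm]
  calc ‖t⁻¹ • (f (x + t • w) - f x) - L w‖
      = ‖t⁻¹ • (f (x + t • w) - f (x + t • v)) + (t⁻¹ • (f (x + t • v) - f x) - L v)
          - (L w - L v)‖ := by
        congr 1; simp only [smul_sub]; abel
    _ ≤ ‖t⁻¹ • (f (x + t • w) - f (x + t • v))‖ + ‖t⁻¹ • (f (x + t • v) - f x) - L v‖
          + ‖L w - L v‖ := (norm_sub_le _ _).trans (by gcongr; exact norm_add_le _ _)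
    _ < ε := by linarith

/-- If the vertices of cones with fixed data are dense near `a`, then `f` is Lipschitz near `a`. -/
theorem eventually_lipschitz_of_dense_coneBound {f : X → Y} {G : Set X} (hG : IsOpen G) {n : ℕ}
    {v : X} {r : ℝ} (hr : 0 < r) {a : X} (haG : a ∈ G)
    (ha : closure {a | ConeBound f G n v r a} ∈ 𝓝 a) :
    ∀ᶠ z : X × X in 𝓝 (a, a), ‖f z.1 - f z.2‖ ≤ 4 * n / r * ‖z.1 - z.2‖ := by
  have hc : ContinuousAt (fun z : X × X => z.2 + (2 / r * ‖z.1 - z.2‖) • (-v)) (a, a) := by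
    fun_prop
  have hc' : ContinuousAt (fun z : X × X => n * (2 / r * ‖z.1 - z.2‖)) (a, a) := by fun_prop
  have hc1 : ContinuousAt (fun z : X × X => z.1) (a, a) := by fun_prop
  have hc2 : ContinuousAt (fun z : X × X => z.2) (a, a) := by fun_prop
  filter_upwards [hc.eventually_mem (by simpa using ha), hc'.eventually_lt_const (u := 1) (by simp),
    hc1.eventually_mem (hG.mem_nhds haG), hc2.eventually_mem (hG.mem_nhds haG)]
    with ⟨y, x⟩ hz hn hy hx
  simp only at hz hn hy hx ⊢
  rcases eq_or_ne y x with rfl | hne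
  · simp
  have hpos : 0 < ‖y - x‖ := norm_pos_iff.2 (sub_ne_zero.2 hne)
  obtain ⟨b, hb, hbx⟩ := Metric.mem_closure_iff.1 hz (r / 2 * (2 / r * ‖y - x‖)) (by positivity)
  exact ConeBound.norm_image_sub_le hr hb hx hy hpos hn (by rwa [mem_ball, dist_comm])

end Hadamard

/-! ### The exceptional set -/

theorem mainTheorem2 {X Y : Type*}
    [NormedAddCommGroup X] [NormedSpace ℝ X] [CompleteSpace X] [TopologicalSpace.SeparableSpace X]
    [NormedAddCommGroup Y] [NormedSpace ℝ Y] [CompleteSpace Y]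
    (G : Set X) (hG : IsOpen G) (f : X → Y)
    (hf : HasBaireProperty (G.domRestrict f))
    (hdiff : ∀ x ∈ G, GateauxDifferentiableAt f x) :
    IsNowhereDense {x ∈ G | ¬ HadamardDifferentiableAt f x} ∧
      SigmaDirectionallyPorous {x ∈ G | ¬ HadamardDifferentiableAt f x} := by
  set N := {x ∈ G | ¬ HadamardDifferentiableAt f x} with hN
  -- the countably many cone conditions
  set A : ℕ × ℕ × ℕ → Set X := fun i =>
    {x | ConeBound f G i.1 (TopologicalSpace.denseSeq X i.2.1) (1 / ((i.2.2 : ℝ) + 1)) x} with hA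
  have hr : ∀ i : ℕ × ℕ × ℕ, 0 < 1 / ((i.2.2 : ℝ) + 1) := fun i => by positivity
  have hcover : ∀ x ∈ G, ∃ i, x ∈ A i := fun x hx => exists_coneBound hG hf hdiff hx
  have hhad : ∀ x ∈ G, Equidirectional f x → HadamardDifferentiableAt f x := fun x hx he =>
    (hdiff x hx).imp fun L hL => he.hasHadamardDerivAt hL
  constructor
  · rw [IsNowhereDense, eq_empty_iff_forall_notMem]
    intro x hx
    have hne : (interior (closure N) ∩ G).Nonempty := by
      obtain ⟨y, hy, hyN⟩ := mem_closure_iff.1 (interior_subset hx) _ isOpen_interior hx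
      exact ⟨y, hy, hyN.1⟩
    have hopen : IsOpen (interior (closure N) ∩ G) := isOpen_interior.inter hG
    -- some `A i` is dense in a nonempty open part of this set
    obtain ⟨i, hi⟩ : ∃ i, ¬ IsMeagre (A i ∩ (interior (closure N) ∩ G)) := by
      by_contra! hcon
      refine not_isMeagre_of_isOpen hopen hne ((isMeagre_iUnion hcon).mono fun y hy => ?_)
      obtain ⟨i, hi⟩ := hcover y hy.2
      exact mem_iUnion.2 ⟨i, hi, hy⟩
    have hi' : (interior (closure (A i ∩ (interior (closure N) ∩ G)))).Nonempty :=
      nonempty_iff_ne_empty.2 fun h => hi (IsNowhereDense.isMeagre h)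
    obtain ⟨z, hz⟩ := hi'
    obtain ⟨a, haW, -, haN, haG⟩ := mem_closure_iff.1 (interior_subset hz) _ isOpen_interior hz
    have haA : closure (A i) ∈ 𝓝 a := mem_of_superset (isOpen_interior.mem_nhds haW)
      (interior_subset.trans (closure_mono inter_subset_left))
    have hlip := eventually_lipschitz_of_dense_coneBound hG (hr i) haG haA
    have hlip' : ∀ᶠ y in 𝓝 a, y ∉ N := by
      have hdiag : Tendsto (fun y : X => (y, y)) (𝓝 a) (𝓝 (a, a)) :=
        (by fun_prop : Continuous fun y : X => (y, y)).tendsto a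
      filter_upwards [hdiag.eventually hlip.eventually_nhds] with y hy hyN
      exact hyN.2 (hhad y hyN.1 (equidirectional_of_lipschitz hy))
    obtain ⟨y, hyN, hy⟩ := mem_closure_iff_frequently.1 (interior_subset haN)
      |>.and_eventually hlip' |>.exists
    exact hy hyN
  · set S : (ℕ × ℕ × ℕ) ⊕ ℕ → Set X := Sum.elim
      (fun i => {x ∈ N | x ∈ A i ∧ ∀ m, ¬ Calm f m x}) (fun m => {x ∈ N | Calm f m x}) with hS
    have hNS : N = ⋃ i, S i := by
      ext x
      rw [mem_iUnion]
      constructor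
      · intro hx
        by_cases hc : ∃ m, Calm f m x
        · obtain ⟨m, hm⟩ := hc
          exact ⟨Sum.inr m, hx, hm⟩
        · obtain ⟨i, hi⟩ := hcover x hx.1
          exact ⟨Sum.inl i, hx, hi, not_exists.1 hc⟩
      · rintro ⟨i | m, hx⟩
        exacts [hx.1, hx.1]
    rw [hNS]
    refine sigmaDirectionallyPorous_iUnion ?_
    rintro (i | m) x hx
    · by_contra hpor
      obtain ⟨m, hm⟩ := exists_calm (ConeBound.eventually_le hG (hr i) hx.1.1 hx.2.1
        fun h => hpor (h.mono fun y hy => hy.2.1))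
      exact hx.2.2 m hm
    · by_contra hpor
      exact hx.1.2 (hhad x hx.1.1 (Calm.equidirectional hx.2
        fun h => hpor (h.mono fun y hy => hy.2)))
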